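/- Let $n\ge 1$ and $r\in(0,1)$. Let $\|\cdot\|$ be the operator norm on complex $n\times n$ matrices induced by the Hilbert norm of $\mathbb{C}^n$, call $T$ a contraction if $\|T\|\le 1$, and let $\rho(T)$ be the spectral radius of $T$. Let $T^*$ (a name, not an adjoint) be the $n\times n$ lower triangular Toeplitz matrix with $T^*_{ii}=r$, $T^*_{ij}=(-r)^{i-j-1}(1-r^2)$ for $i>j$ and $T^*_{ij}=0$ for $i<j$, and let $X_{1+r}$ be the $n\times n$ matrix with entries $1$ on the diagonal, $1+r$ below the diagonal and $0$ above it. Then for every $n\times n$ contraction $T$ with $\rho(T)\le r$ and every $\zeta\in\mathbb{C}$ with $|\zeta|\ge 1$, the matrix $\zeta-T$ is invertible and $$\|(\zeta-T)^{-1}\|\le\|(1-T^*)^{-1}\|=\frac{1}{1-r}\,\|X_{1+r}\|,$$ where $1-T^*$ is invertible. Moreover $T^*$ is itself a contraction with $\rho(T^*)\le r$. Hence, for every $\zeta$ with $|\zeta|=1$, $$\mathcal{R}_{n,r}:=\sup\{\|(\zeta-T)^{-1}\| : \|T\|\le 1,\ \rho(T)\le r\}=\|(1-T^*)^{-1}\|,$$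 and this supremum is attained; for $\zeta=1$ it is attained by $T=T^*$. The supremum of $\|(\zeta-T)^{-1}\|$ over all $|\zeta|\ge1$ and all such $T$ has the same value and is attained (at $\zeta=1$ by $T^*$). -/

import Mathlib

/- The norm `‖·‖` on complex matrices is the operator norm induced by the Hilbert norm on `ℂⁿ`. -/
open scoped Matrix.Norms.L2Operator

/-- The complex `n × n` contractions whose spectral radius is at most `r`. -/
def contractionsWithRadius (n : ℕ) (r : ℝ) : Set (Matrix (Fin n) (Fin n) ℂ) :=
  {T | ‖T‖ ≤ 1 ∧ spectralRadius ℂ T ≤ ENNReal.ofReal r}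

/-- The values `‖R(ζ, T)‖`, where `R(ζ, T) = (ζ - T)⁻¹` and `T` runs over the `n × n`
contractions of spectral radius at most `r`. -/
def resolventNorms (n : ℕ) (r : ℝ) (ζ : ℂ) : Set ℝ :=
  {x | ∃ T ∈ contractionsWithRadius n r, x = ‖resolvent T ζ‖}

/-- The supremum of `‖R(ζ, T)‖` over the `n × n` contractions `T` of spectral radius at most `r`,
at a given point `ζ`. -/
noncomputable def resolventSup (n : ℕ) (r : ℝ) (ζ : ℂ) : ℝ :=
  sSup (resolventNorms n r ζ)

/-- The lower triangular Toeplitz matrix with `r` on the diagonal and `(-r)^(k-1) (1 - r²)` on the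
`k`-th subdiagonal, `k ≥ 1`. -/
noncomputable def extremalToeplitz (n : ℕ) (r : ℝ) : Matrix (Fin n) (Fin n) ℂ :=
  Matrix.of fun i j =>
    if i < j then 0
    else if i = j then (r : ℂ)
    else (-(r : ℂ)) ^ ((i : ℕ) - (j : ℕ) - 1) * (1 - (r : ℂ) ^ 2)

/-- The lower triangular Toeplitz matrix with `1` on the diagonal and `β` below it. -/
noncomputable def lowerToeplitzX (n : ℕ) (β : ℝ) : Matrix (Fin n) (Fin n) ℂ :=
  Matrix.of fun i j => if i < j then 0 else if i = j then 1 else (β : ℂ)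

/-! ### Positivity and entrywise norm bounds -/

namespace Matrix

open scoped MatrixOrder ComplexOrder

variable {n : ℕ}

/-! Scaling by `ζ⁻¹` reduces to `ζ = 1`, and a Schur basis makes `T` lower triangular. Then `K = (1
- T)⁻¹` is lower triangular with diagonal entries at most `1/(1-r)` in modulus, and contractivity of
`T` says exactly that `K + Kᴴ - 1` is positive semidefinite
(`posSemidef_add_conjTranspose_sub_one_iff`). A positive semidefinite matrix has no entry larger
than its diagonal bound, here `2/(1-r) - 1 = (1+r)/(1-r)`. So `K` is dominated entrywise by
`X_{1+r}/(1-r)`, hence also in norm. For `T*` every one of these estimates is an equality: `(1 -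
T*)⁻¹ = X_{1+r}/(1-r)`, and its positivity matrix is a multiple of the all-ones matrix. -/

theorem posSemidef_one_sub_conjTranspose_mul_self_iff (S : Matrix (Fin n) (Fin n) ℂ) :
    (1 - Sᴴ * S).PosSemidef ↔ ‖S‖ ≤ 1 := by
  let : CStarAlgebra (Matrix (Fin n) (Fin n) ℂ) := {}
  rw [← le_iff, ← CStarAlgebra.norm_le_one_iff_of_nonneg (Sᴴ * S)
    (posSemidef_conjTranspose_mul_self S).nonneg, l2_opNorm_conjTranspose_mul_self]
  constructor
  · intro h
    nlinarith [norm_nonneg S]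
  · intro h
    nlinarith [norm_nonneg S]

theorem PosSemidef.norm_apply_le {P : Matrix (Fin n) (Fin n) ℂ} (hP : P.PosSemidef) {c : ℝ}
    (hc : ∀ i, (P i i).re ≤ c) (i j : Fin n) : ‖P i j‖ ≤ c := by
  have hdet := (hP.submatrix ![i, j]).det_nonneg
  have hi := hP.diag_nonneg (i := i)
  have hj := hP.diag_nonneg (i := j)
  have hij : P j i = star (P i j) := (hP.1.apply j i).symm
  rw [det_fin_two] at hdet
  simp only [submatrix_apply, cons_val_zero, cons_val_one] at hdet
  rw [hij] at hdet
  have h1 := (Complex.le_def.1 hdet).1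
  have hi1 := Complex.le_def.1 hi
  have hj1 := Complex.le_def.1 hj
  have h2 : (P i j * star (P i j)).re = ‖P i j‖ ^ 2 := by
    rw [Complex.star_def, Complex.mul_conj, Complex.normSq_eq_norm_sq, Complex.ofReal_re]
  simp only [Complex.zero_re, Complex.sub_re, Complex.mul_re (P i i), Complex.zero_im, h2]
    at h1 hi1 hj1
  rw [← hi1.2] at h1
  have := hc i
  have := hc j
  refine abs_le_of_sq_le_sq' ?_ (by linarith [hi1.1]) |>.2
  -- The 2×2 principal minor gives `|P i j|² ≤ P i i * P j j ≤ c²`.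
  nlinarith [mul_nonneg hi1.1 (sub_nonneg.2 (hc j)), hi1.1, hj1.1]

/-- Coordinatewise `|A x| ≤ B |x|`, and `|x|` has the same Hilbert norm as `x`. -/
theorem l2_opNorm_le_of_norm_apply_le {A : Matrix (Fin n) (Fin n) ℂ}
    {B : Matrix (Fin n) (Fin n) ℝ} (h : ∀ i j, ‖A i j‖ ≤ B i j) :
    ‖A‖ ≤ ‖B.map ((↑) : ℝ → ℂ)‖ := by
  rw [l2_opNorm_def A]
  refine ContinuousLinearMap.opNorm_le_bound _ (norm_nonneg _) fun x => ?_
  let y : EuclideanSpace ℂ (Fin n) := WithLp.toLp 2 fun i => (‖x i‖ : ℂ)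
  have hy : ‖y‖ = ‖x‖ := by
    simp [EuclideanSpace.norm_eq, y]
  rw [← hy]
  refine le_trans ?_ (l2_opNorm_mulVec (B.map ((↑) : ℝ → ℂ)) y)
  rw [EuclideanSpace.norm_eq, EuclideanSpace.norm_eq]
  refine Real.sqrt_le_sqrt (Finset.sum_le_sum fun i _ => ?_)
  refine pow_le_pow_left₀ (norm_nonneg _) ?_ 2
  have hB : (B.map ((↑) : ℝ → ℂ) *ᵥ y) i = ((∑ j, B i j * ‖x j‖ : ℝ) : ℂ) := by
    simp [mulVec, dotProduct, y]
  have hA : ‖(A *ᵥ x) i‖ ≤ ∑ j, B i j * ‖x j‖ := by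
    change ‖∑ j, A i j * x j‖ ≤ _
    refine (norm_sum_le _ _).trans (Finset.sum_le_sum fun j _ => ?_)
    rw [norm_mul]
    exact mul_le_mul_of_nonneg_right (h i j) (norm_nonneg _)
  refine hA.trans ?_
  change _ ≤ ‖(B.map ((↑) : ℝ → ℂ) *ᵥ y) i‖
  rw [hB, Complex.norm_real]
  exact le_abs_self _

end Matrix

/-! ### Schur triangularisation and the spectrum -/

theorem LinearMap.exists_orthonormal_lowerTriangular {n : ℕ} {E : Type*} [NormedAddCommGroup E]
    [InnerProductSpace ℂ E] [FiniteDimensional ℂ E] (hE : Module.finrank ℂ E = n) (f : E →ₗ[ℂ] E) :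
    ∃ b : Fin n → E, Orthonormal ℂ b ∧ ∀ i j, i < j → inner ℂ (b i) (f (b j)) = 0 := by
  induction n generalizing E with
  | zero => exact ⟨fun i => i.elim0, ⟨fun i => i.elim0, fun i => i.elim0⟩, fun i => i.elim0⟩
  | succ n ih =>
    have : Nontrivial E := Module.nontrivial_of_finrank_pos (R := ℂ) (by omega)
    -- An eigenvector of the adjoint is used because its orthogonal complement is `f`-invariant; the
    -- induction continues there.
    obtain ⟨μ, hμ⟩ := Module.End.exists_eigenvalue f.adjoint
    obtain ⟨w, hw, hw0⟩ := hμ.exists_hasEigenvector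
    rw [Module.End.mem_eigenspace_iff] at hw
    let v : E := ((‖w‖ : ℂ)⁻¹) • w
    have hv : ‖v‖ = 1 := norm_smul_inv_norm hw0
    have hfv : f.adjoint v = μ • v := by
      simp only [v, map_smul, hw, smul_comm μ]
    have hinv : ∀ x : E, inner ℂ v x = 0 → inner ℂ v (f x) = 0 := by
      intro x hx
      rw [← LinearMap.adjoint_inner_left, hfv, inner_smul_left, hx, mul_zero]
    have hmem : ∀ x : (ℂ ∙ v)ᗮ, inner ℂ v (x : E) = 0 := fun x =>
      Submodule.mem_orthogonal_singleton_iff_inner_right.1 x.2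
    let g : (ℂ ∙ v)ᗮ →ₗ[ℂ] (ℂ ∙ v)ᗮ := f.restrict fun x hx =>
      Submodule.mem_orthogonal_singleton_iff_inner_right.2
        (hinv x (Submodule.mem_orthogonal_singleton_iff_inner_right.1 hx))
    have hv0 : v ≠ 0 := by
      intro h
      simp [h] at hv
    have : Fact (Module.finrank ℂ E = n + 1) := ⟨hE⟩
    obtain ⟨b, hb, hbt⟩ := ih (Submodule.finrank_orthogonal_span_singleton hv0) g
    refine ⟨Fin.cons v fun i => (b i : E), ⟨?_, ?_⟩, ?_⟩
    · intro i
      cases i using Fin.cases with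
      | zero => exact hv
      | succ i => exact hb.1 i
    · intro i j hij
      cases i using Fin.cases with
      | zero =>
        cases j using Fin.cases with
        | zero => exact absurd rfl hij
        | succ j => exact hmem (b j)
      | succ i =>
        cases j using Fin.cases with
        | zero => exact inner_eq_zero_symm.1 (hmem (b i))
        | succ j => exact hb.2 fun h => hij (congrArg Fin.succ h)
    · intro i j hij
      cases j using Fin.cases with
      | zero => exact absurd hij (Fin.not_lt_zero i)
      | succ j =>
        cases i using Fin.cases with
        | zero => exact hinv _ (hmem (b j))
        | succ i => exact hbt i j (Fin.succ_lt_succ_iff.1 hij)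

namespace Matrix

open scoped MatrixOrder ComplexOrder

variable {n : ℕ}

theorem exists_unitary_conj_lowerTriangular (T : Matrix (Fin n) (Fin n) ℂ) :
    ∃ U : unitaryGroup (Fin n) ℂ,
      (star (U : Matrix (Fin n) (Fin n) ℂ) * T * U).IsLowerTriangular := by
  obtain ⟨b, hb, hbt⟩ := LinearMap.exists_orthonormal_lowerTriangular
    (finrank_euclideanSpace_fin (𝕜 := ℂ) (n := n)) (toEuclideanLin T)
  let U : Matrix (Fin n) (Fin n) ℂ := of fun i j => b j i
  have hU : star U * U = 1 := by
    ext i j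
    have := orthonormal_iff_ite.1 hb i j
    rw [one_apply, ← this, EuclideanSpace.inner_eq_star_dotProduct, dotProduct_comm]
    rfl
  refine ⟨⟨U, mem_unitaryGroup_iff'.2 hU⟩, fun i j hij => ?_⟩
  rw [← hbt i j hij, EuclideanSpace.inner_eq_star_dotProduct, dotProduct_comm, mul_assoc]
  rfl

theorem IsLowerTriangular.mem_spectrum_iff {A : Matrix (Fin n) (Fin n) ℂ}
    (hA : A.IsLowerTriangular) {z : ℂ} : z ∈ spectrum ℂ A ↔ ∃ i, A i i = z := by
  have h := charpoly_of_isUpperTriangular Aᵀ hA.transpose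
  rw [charpoly_transpose] at h
  rw [mem_spectrum_iff_isRoot_charpoly, h, Polynomial.IsRoot.def, Polynomial.eval_prod,
    Finset.prod_eq_zero_iff]
  simp [sub_eq_zero, eq_comm]

theorem spectralRadius_le_ofReal_iff {A : Matrix (Fin n) (Fin n) ℂ} {r : ℝ} (hr : 0 ≤ r) :
    spectralRadius ℂ A ≤ ENNReal.ofReal r ↔ ∀ z ∈ spectrum ℂ A, ‖z‖ ≤ r := by
  simp only [spectralRadius, iSup_le_iff]
  refine forall₂_congr fun z _ => ?_
  rw [← enorm_eq_nnnorm, ← ofReal_norm, ENNReal.ofReal_le_ofReal_iff hr]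

end Matrix
-- The upper bound at `ζ = 1`
namespace Matrix

open scoped MatrixOrder ComplexOrder

variable {n : ℕ}

/-- Since `S * G = G - 1`, the matrix `G + Gᴴ - 1` is congruent to `1 - Sᴴ * S` via the invertible
`G`. -/
theorem posSemidef_add_conjTranspose_sub_one_iff {S G : Matrix (Fin n) (Fin n) ℂ}
    (hG : G * (1 - S) = 1) : (G + Gᴴ - 1).PosSemidef ↔ ‖S‖ ≤ 1 := by
  have hG' : (1 - S) * G = 1 := mul_eq_one_comm.1 hG
  have hS : S * G = G - 1 := by
    rw [sub_mul, one_mul] at hG'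
    rw [← hG', sub_sub_cancel]
  have key : Gᴴ * (1 - Sᴴ * S) * G = G + Gᴴ - 1 := by
    have : Gᴴ * (1 - Sᴴ * S) * G = Gᴴ * G - (S * G)ᴴ * (S * G) := by
      rw [conjTranspose_mul]; noncomm_ring
    rw [this, hS, conjTranspose_sub, conjTranspose_one]
    noncomm_ring
  have key' : (1 - S)ᴴ * (G + Gᴴ - 1) * (1 - S) = 1 - Sᴴ * S := by
    have h1 : (1 - S)ᴴ * Gᴴ = 1 := by rw [← conjTranspose_mul, hG, conjTranspose_one]
    rw [← key]
    calc _ = ((1 - S)ᴴ * Gᴴ) * (1 - Sᴴ * S) * (G * (1 - S)) := by noncomm_ring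
      _ = _ := by rw [h1, hG, one_mul, mul_one]
  rw [← posSemidef_one_sub_conjTranspose_mul_self_iff]
  constructor
  · intro h
    rw [← key']
    exact h.conjTranspose_mul_mul_same _
  · intro h
    rw [← key]
    exact h.conjTranspose_mul_mul_same _

theorem IsLowerTriangular.inv {A : Matrix (Fin n) (Fin n) ℂ} (hA : A.IsLowerTriangular)
    (h : IsUnit A) : A⁻¹.IsLowerTriangular := by
  obtain ⟨_⟩ := h.nonempty_invertible
  exact blockTriangular_inv_of_blockTriangular hA

theorem IsLowerTriangular.mul_apply_self {A B : Matrix (Fin n) (Fin n) ℂ}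
    (hA : A.IsLowerTriangular) (hB : B.IsLowerTriangular) (i : Fin n) :
    (A * B) i i = A i i * B i i := by
  rw [mul_apply]
  refine Finset.sum_eq_single i (fun k _ hk => ?_) (fun h => absurd (Finset.mem_univ i) h)
  rcases lt_or_gt_of_ne hk with h | h
  · rw [hB (show OrderDual.toDual i < OrderDual.toDual k from h), mul_zero]
  · rw [hA (show OrderDual.toDual k < OrderDual.toDual i from h), zero_mul]

theorem map_ofReal_eq_smul_lowerToeplitzX {r : ℝ} :
    (Matrix.of fun i j : Fin n => if i < j then (0 : ℝ) else if i = j then 1 / (1 - r)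
      else (1 + r) / (1 - r)).map ((↑) : ℝ → ℂ) =
      ((1 / (1 - r) : ℝ) : ℂ) • lowerToeplitzX n (1 + r) := by
  ext i j
  simp only [map_apply, of_apply, smul_apply, lowerToeplitzX, smul_eq_mul]
  split_ifs
  · simp
  · simp
  · push_cast; ring

theorem norm_one_div_smul_lowerToeplitzX {r : ℝ} (hr : r < 1) :
    ‖((1 / (1 - r) : ℝ) : ℂ) • lowerToeplitzX n (1 + r)‖ =
      1 / (1 - r) * ‖lowerToeplitzX n (1 + r)‖ := by
  rw [norm_smul, Complex.norm_real, Real.norm_of_nonneg (one_div_nonneg.2 (by linarith))]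

theorem _root_.Complex.norm_inv_one_sub_le {z : ℂ} {r : ℝ} (hr : r < 1) (hz : ‖z‖ ≤ r) :
    ‖(1 - z)⁻¹‖ ≤ 1 / (1 - r) := by
  rw [norm_inv, ← one_div]
  refine one_div_le_one_div_of_le (by linarith) ?_
  have := norm_sub_norm_le (1 : ℂ) z
  rw [norm_one] at this
  linarith

theorem isUnit_one_sub_of_spectrum {T : Matrix (Fin n) (Fin n) ℂ} {r : ℝ} (hr : r < 1)
    (hs : ∀ z ∈ spectrum ℂ T, ‖z‖ ≤ r) : IsUnit (1 - T) := by
  have h : (1 : ℂ) ∉ spectrum ℂ T := fun h => by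
    have := hs 1 h
    rw [norm_one] at this
    linarith
  rw [spectrum.notMem_iff, map_one] at h
  exact h

theorem IsLowerTriangular.norm_inv_one_sub_le {A : Matrix (Fin n) (Fin n) ℂ}
    (hA : A.IsLowerTriangular) (hA1 : ‖A‖ ≤ 1) {r : ℝ} (hr : r < 1)
    (hs : ∀ z ∈ spectrum ℂ A, ‖z‖ ≤ r) :
    ‖(1 - A)⁻¹‖ ≤ 1 / (1 - r) * ‖lowerToeplitzX n (1 + r)‖ := by
  have hu := isUnit_one_sub_of_spectrum hr hs
  have hl : (1 - A).IsLowerTriangular := blockTriangular_one.sub hA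
  set K := (1 - A)⁻¹ with hK
  have hKl : K.IsLowerTriangular := hl.inv hu
  have hKA : K * (1 - A) = 1 := nonsing_inv_mul _ ((isUnit_iff_isUnit_det _).1 hu)
  have hdiag : ∀ i, ‖K i i‖ ≤ 1 / (1 - r) := fun i => by
    have h1 : K i i * (1 - A i i) = 1 := by
      have := hKl.mul_apply_self hl i
      rw [hKA, one_apply_eq, sub_apply, one_apply_eq] at this
      exact this.symm
    rw [eq_inv_of_mul_eq_one_left h1]
    exact Complex.norm_inv_one_sub_le hr (hs _ (hA.mem_spectrum_iff.2 ⟨i, rfl⟩))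
  have hP := (posSemidef_add_conjTranspose_sub_one_iff hKA).2 hA1
  have hPd : ∀ i, ((K + Kᴴ - 1) i i).re ≤ (1 + r) / (1 - r) := fun i => by
    have h1 := (Complex.re_le_norm (K i i)).trans (hdiag i)
    have h2 : (1 + r) / (1 - r) = 1 / (1 - r) + 1 / (1 - r) - 1 := by
      field_simp [show (1 - r) ≠ 0 by linarith]
      ring
    simp only [sub_apply, add_apply, conjTranspose_apply, one_apply_eq, Complex.sub_re,
      Complex.add_re, Complex.star_def, Complex.conj_re, Complex.one_re]
    linarith
  rw [← norm_one_div_smul_lowerToeplitzX hr, ← map_ofReal_eq_smul_lowerToeplitzX]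
  refine l2_opNorm_le_of_norm_apply_le fun i j => ?_
  rw [of_apply]
  split_ifs with h h'
  · rw [hKl (show OrderDual.toDual j < OrderDual.toDual i from h), norm_zero]
  · rw [← h']
    exact hdiag i
  -- Strictly below the diagonal, `Kᴴ` and `1` vanish, so the entry of `K + Kᴴ - 1` is that of `K`.
  · have hji : j < i := lt_of_le_of_ne (not_lt.1 h) (Ne.symm h')
    have := hP.norm_apply_le hPd i j
    rwa [sub_apply, add_apply, conjTranspose_apply,
      hKl (show OrderDual.toDual i < OrderDual.toDual j from hji), one_apply_ne h', star_zero,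
      add_zero, sub_zero] at this

theorem norm_inv_one_sub_le_of_contraction {T : Matrix (Fin n) (Fin n) ℂ} (hT : ‖T‖ ≤ 1) {r : ℝ}
    (hr : r < 1) (hs : ∀ z ∈ spectrum ℂ T, ‖z‖ ≤ r) :
    ‖(1 - T)⁻¹‖ ≤ 1 / (1 - r) * ‖lowerToeplitzX n (1 + r)‖ := by
  obtain ⟨U, hU⟩ := exists_unitary_conj_lowerTriangular T
  have hUU : star (U : Matrix (Fin n) (Fin n) ℂ) * U = 1 := Unitary.coe_star_mul_self U
  have hUU' : (U : Matrix (Fin n) (Fin n) ℂ) * star (U : Matrix (Fin n) (Fin n) ℂ) = 1 :=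
    Unitary.coe_mul_star_self U
  have hnorm : ∀ B : Matrix (Fin n) (Fin n) ℂ,
      ‖star (U : Matrix (Fin n) (Fin n) ℂ) * B * U‖ = ‖B‖ := fun B => by
    rw [CStarRing.norm_mul_coe_unitary, ← Unitary.coe_star, CStarRing.norm_coe_unitary_mul]
  have hinv : (1 - star (U : Matrix (Fin n) (Fin n) ℂ) * T * U)⁻¹ =
      star (U : Matrix (Fin n) (Fin n) ℂ) * (1 - T)⁻¹ * U := by
    refine inv_eq_right_inv ?_
    have h1 : (1 - T) * (1 - T)⁻¹ = 1 :=
      mul_nonsing_inv _ ((isUnit_iff_isUnit_det _).1 (isUnit_one_sub_of_spectrum hr hs))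
    calc _ = (star (U : Matrix (Fin n) (Fin n) ℂ) * U - star (U : Matrix (Fin n) (Fin n) ℂ) * T * U)
          * (star (U : Matrix (Fin n) (Fin n) ℂ) * (1 - T)⁻¹ * U) := by rw [hUU]
      _ = star (U : Matrix (Fin n) (Fin n) ℂ) * ((1 - T) * (U * star (U : Matrix (Fin n) (Fin n) ℂ))
          * (1 - T)⁻¹) * U := by noncomm_ring
      _ = 1 := by rw [hUU', mul_one, h1, mul_one, hUU]
  rw [← hnorm, ← hinv]
  refine hU.norm_inv_one_sub_le ?_ hr ?_
  · rwa [hnorm]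
  · rwa [Unitary.spectrum_star_left_conjugate]

/-! ### The extremal matrix -/

/-- The lower shift, with ones on the first subdiagonal. -/
def lowerShift (n : ℕ) : Matrix (Fin n) (Fin n) ℂ :=
  of fun i j => if (j : ℕ) + 1 = i then 1 else 0

theorem lowerShift_mul_apply (A : Matrix (Fin n) (Fin n) ℂ) (i j : Fin n) :
    (lowerShift n * A) i j =
      if 0 < (i : ℕ) then A ⟨(i : ℕ) - 1, (Nat.sub_le _ _).trans_lt i.2⟩ j else 0 := by
  simp only [mul_apply, lowerShift, of_apply, ite_mul, one_mul, zero_mul]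
  split_ifs with h
  · rw [Finset.sum_eq_single ⟨(i : ℕ) - 1, (Nat.sub_le _ _).trans_lt i.2⟩]
    · exact if_pos (Nat.sub_add_cancel h)
    · intro k _ hk
      refine if_neg fun h' => hk (Fin.ext ?_)
      exact (Nat.sub_eq_of_eq_add h'.symm).symm
    · exact fun h => absurd (Finset.mem_univ _) h
  · exact Finset.sum_eq_zero fun k _ => if_neg (by omega)

/-- `T*` is the disc automorphism `(r + z)/(1 + r z)` evaluated at the nilpotent shift. -/
theorem one_add_smul_lowerShift_mul_extremalToeplitz (r : ℝ) :
    (1 + (r : ℂ) • lowerShift n) * extremalToeplitz n r = (r : ℂ) • 1 + lowerShift n := by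
  ext i j
  rw [add_mul, one_mul, smul_mul_assoc, add_apply, smul_apply, lowerShift_mul_apply]
  simp only [extremalToeplitz, of_apply, Fin.lt_def, Fin.ext_iff, add_apply, smul_apply, one_apply,
    lowerShift, smul_eq_mul]
  obtain h | h | h | h : (i : ℕ) < j ∨ (i : ℕ) = j ∨ (i : ℕ) = j + 1 ∨ ∃ k, (i : ℕ) = j + 2 + k := by
    rcases lt_or_ge (i : ℕ) (j + 2) with h | h
    · omega
    · exact Or.inr (Or.inr (Or.inr (Nat.exists_eq_add_of_le h)))
  · grind
  · grind
  · have h1 : (i : ℕ) - 1 = j := by omega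
    simp only [h, Nat.add_sub_cancel]
    grind
  · obtain ⟨k, h⟩ := h
    have h1 : (i : ℕ) - j - 1 = k + 1 := by omega
    have h2 : (i : ℕ) - 1 - j - 1 = k := by omega
    rw [h1, h2]
    rw [if_neg (show ¬(i : ℕ) < j by omega), if_neg (show ¬(i : ℕ) = j by omega),
      if_pos (show 0 < (i : ℕ) by omega), if_neg (show ¬(i : ℕ) - 1 < j by omega),
      if_neg (show ¬(i : ℕ) - 1 = j by omega), if_neg (show ¬(i : ℕ) = j by omega),
      if_neg (show ¬(j : ℕ) + 1 = i by omega)]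
    ring

theorem one_sub_lowerShift_mul_lowerToeplitzX (r : ℝ) :
    (1 - lowerShift n) * lowerToeplitzX n (1 + r) = 1 + (r : ℂ) • lowerShift n := by
  ext i j
  rw [sub_mul, one_mul, sub_apply, lowerShift_mul_apply]
  simp only [lowerToeplitzX, of_apply, Fin.lt_def, Fin.ext_iff, add_apply, smul_apply, one_apply,
    lowerShift, smul_eq_mul]
  push_cast
  grind

theorem isUnit_one_add_smul_lowerShift (c : ℂ) : IsUnit (1 + c • lowerShift n) := by
  have h : (1 + c • lowerShift n).IsLowerTriangular := fun i j hij => by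
    have hij : (i : ℕ) < j := hij
    simp only [add_apply, smul_apply, lowerShift, of_apply, one_apply, Fin.ext_iff]
    rw [if_neg (by omega), if_neg (by omega), smul_zero, add_zero]
  rw [isUnit_iff_isUnit_det, det_of_isLowerTriangular _ h]
  simp [lowerShift]

theorem smul_lowerToeplitzX_mul_one_sub_extremalToeplitz {r : ℝ} (hr : r < 1) :
    (((1 / (1 - r) : ℝ) : ℂ) • lowerToeplitzX n (1 + r)) * (1 - extremalToeplitz n r) = 1 := by
  rw [mul_eq_one_comm]
  refine (isUnit_one_add_smul_lowerShift (r : ℂ)).mul_left_cancel ?_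
  have h1 : (1 + (r : ℂ) • lowerShift n) * (1 - extremalToeplitz n r) =
      (1 - (r : ℂ)) • (1 - lowerShift n) := by
    rw [mul_sub, mul_one, one_add_smul_lowerShift_mul_extremalToeplitz]
    module
  have h2 : (1 : ℂ) - r ≠ 0 := by
    exact_mod_cast (sub_pos.2 hr).ne'
  rw [← mul_assoc, h1, mul_smul_comm, smul_mul_assoc, one_sub_lowerShift_mul_lowerToeplitzX,
    smul_smul, mul_one]
  push_cast
  rw [one_div_mul_cancel h2, one_smul]

theorem inv_one_sub_extremalToeplitz {r : ℝ} (hr : r < 1) :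
    (1 - extremalToeplitz n r)⁻¹ = ((1 / (1 - r) : ℝ) : ℂ) • lowerToeplitzX n (1 + r) :=
  inv_eq_left_inv (smul_lowerToeplitzX_mul_one_sub_extremalToeplitz hr)

theorem norm_extremalToeplitz_le_one {r : ℝ} (hr0 : 0 ≤ r) (hr : r < 1) :
    ‖extremalToeplitz n r‖ ≤ 1 := by
  rw [← posSemidef_add_conjTranspose_sub_one_iff
    (smul_lowerToeplitzX_mul_one_sub_extremalToeplitz hr)]
  have h : ((1 / (1 - r) : ℝ) : ℂ) • lowerToeplitzX n (1 + r) +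
      (((1 / (1 - r) : ℝ) : ℂ) • lowerToeplitzX n (1 + r))ᴴ - 1 =
      (((1 + r) / (1 - r) : ℝ) : ℂ) • vecMulVec (1 : Fin n → ℂ) (star 1) := by
    have h2 : (1 : ℂ) - r ≠ 0 := by
      exact_mod_cast (sub_pos.2 hr).ne'
    ext i j
    simp only [sub_apply, add_apply, conjTranspose_apply, smul_apply, lowerToeplitzX, of_apply,
      one_apply, vecMulVec_apply, Pi.one_apply, star_one, smul_eq_mul, star_mul',
      Complex.star_def, Complex.conj_ofReal, apply_ite (starRingEnd ℂ), map_zero, map_one]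
    rcases lt_trichotomy i j with h | h | h
    · rw [if_pos h, if_neg h.asymm, if_neg h.ne', if_neg h.ne]
      push_cast; ring
    · subst h
      simp only [lt_irrefl, if_true, if_false]
      push_cast
      field_simp
      ring
    · rw [if_pos h, if_neg h.asymm, if_neg h.ne', if_neg h.ne']
      push_cast; ring
  -- What remains is a nonnegative multiple of a rank-one projection-type matrix `v vᴴ`, with `v`
  -- the all-ones vector.
  rw [h]
  refine (posSemidef_vecMulVec_self_star _).smul ?_
  exact_mod_cast div_nonneg (by linarith) (by linarith)

theorem norm_le_of_mem_spectrum_extremalToeplitz {r : ℝ} (hr0 : 0 ≤ r) :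
    ∀ z ∈ spectrum ℂ (extremalToeplitz n r), ‖z‖ ≤ r := by
  have h : (extremalToeplitz n r).IsLowerTriangular := fun i j hij =>
    if_pos (show i < j from hij)
  intro z hz
  obtain ⟨i, rfl⟩ := h.mem_spectrum_iff.1 hz
  simp [extremalToeplitz, abs_of_nonneg hr0]

/-! ### Passing to general `ζ` -/

theorem resolvent_one (T : Matrix (Fin n) (Fin n) ℂ) : resolvent T (1 : ℂ) = (1 - T)⁻¹ := by
  rw [resolvent, map_one, nonsing_inv_eq_ringInverse]

theorem norm_le_of_mem_spectrum_smul {T : Matrix (Fin n) (Fin n) ℂ} {r : ℝ}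
    (hs : ∀ z ∈ spectrum ℂ T, ‖z‖ ≤ r) {c : ℂ} (hc0 : c ≠ 0) (hc : ‖c‖ ≤ 1) :
    ∀ z ∈ spectrum ℂ (c • T), ‖z‖ ≤ r := by
  intro z hz
  have hz' : c • (c⁻¹ * z) ∈ spectrum ℂ (c • T) := by
    rwa [smul_eq_mul, mul_inv_cancel_left₀ hc0]
  have hw : c⁻¹ * z ∈ spectrum ℂ T :=
    (spectrum.smul_mem_smul_iff (r := Units.mk0 c hc0)).1 hz'
  calc ‖z‖ = ‖c‖ * ‖c⁻¹ * z‖ := by rw [← norm_mul, mul_inv_cancel_left₀ hc0]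
    _ ≤ ‖c⁻¹ * z‖ := mul_le_of_le_one_left (norm_nonneg _) hc
    _ ≤ r := hs _ hw

theorem norm_resolvent_le_of_contraction {T : Matrix (Fin n) (Fin n) ℂ} (hT : ‖T‖ ≤ 1) {r : ℝ}
    (hr : r < 1) (hs : ∀ z ∈ spectrum ℂ T, ‖z‖ ≤ r) {ζ : ℂ} (hζ : 1 ≤ ‖ζ‖) :
    ‖resolvent T ζ‖ ≤ ‖(1 - extremalToeplitz n r)⁻¹‖ := by
  have hζ0 : ζ ≠ 0 := norm_pos_iff.1 (one_pos.trans_le hζ)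
  have hi : ‖ζ⁻¹‖ ≤ 1 := by
    rw [norm_inv]
    exact inv_le_one_of_one_le₀ hζ
  have hres : ζ • resolvent T ζ = resolvent (ζ⁻¹ • T) (1 : ℂ) :=
    spectrum.units_smul_resolvent_self (r := Units.mk0 ζ hζ0) (a := T)
  rw [resolvent_one] at hres
  have hS := norm_le_of_mem_spectrum_smul hs (inv_ne_zero hζ0) hi
  have hS1 : ‖ζ⁻¹ • T‖ ≤ 1 := by
    rw [norm_smul]
    exact mul_le_one₀ hi (norm_nonneg _) hT
  have hb := norm_inv_one_sub_le_of_contraction hS1 hr hS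
  rw [inv_one_sub_extremalToeplitz hr, norm_one_div_smul_lowerToeplitzX hr]
  refine le_trans ?_ hb
  rw [← hres, norm_smul]
  exact le_mul_of_one_le_left (norm_nonneg _) hζ

theorem smul_mem_contractionsWithRadius {T : Matrix (Fin n) (Fin n) ℂ} {r : ℝ} (hr : 0 ≤ r)
    (hT : T ∈ contractionsWithRadius n r) {ζ : ℂ} (hζ : ‖ζ‖ = 1) :
    ζ • T ∈ contractionsWithRadius n r := by
  have hζ0 : ζ ≠ 0 := norm_ne_zero_iff.1 (hζ ▸ one_ne_zero)
  refine ⟨by rw [norm_smul, hζ, one_mul]; exact hT.1, ?_⟩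
  rw [spectralRadius_le_ofReal_iff hr]
  exact norm_le_of_mem_spectrum_smul ((spectralRadius_le_ofReal_iff hr).1 hT.2) hζ0 hζ.le

theorem norm_resolvent_smul_self (T : Matrix (Fin n) (Fin n) ℂ) {ζ : ℂ} (hζ : ‖ζ‖ = 1) :
    ‖resolvent (ζ • T) ζ‖ = ‖(1 - T)⁻¹‖ := by
  have hζ0 : ζ ≠ 0 := norm_ne_zero_iff.1 (hζ ▸ one_ne_zero)
  have hres : ζ • resolvent (ζ • T) ζ = resolvent (ζ⁻¹ • ζ • T) (1 : ℂ) :=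
    spectrum.units_smul_resolvent_self (r := Units.mk0 ζ hζ0) (a := ζ • T)
  rw [inv_smul_smul₀ hζ0, resolvent_one] at hres
  rw [← hres, norm_smul, hζ, one_mul]

end Matrix

theorem theorem1 (n : ℕ) (hn : 1 ≤ n) (r : ℝ) (hr : r ∈ Set.Ioo (0 : ℝ) 1) :
    -- `1 - T*` is invertible
    IsUnit (1 - extremalToeplitz n r) ∧
    -- the resolvent bound (the resolvent exists at every such `ζ`)
    (∀ T : Matrix (Fin n) (Fin n) ℂ, ‖T‖ ≤ 1 → spectralRadius ℂ T ≤ ENNReal.ofReal r →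
      ∀ ζ : ℂ, 1 ≤ ‖ζ‖ →
        ζ ∉ spectrum ℂ T ∧ ‖resolvent T ζ‖ ≤ ‖(1 - extremalToeplitz n r)⁻¹‖) ∧
    -- the value of the bound
    ‖(1 - extremalToeplitz n r)⁻¹‖ = 1 / (1 - r) * ‖lowerToeplitzX n (1 + r)‖ ∧
    -- `T*` is admissible and attains the bound at `ζ = 1`
    extremalToeplitz n r ∈ contractionsWithRadius n r ∧
    ‖resolvent (extremalToeplitz n r) (1 : ℂ)‖ = ‖(1 - extremalToeplitz n r)⁻¹‖ ∧
    -- at each point of the unit circle the supremum is a maximum, with this value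
    (∀ ζ : ℂ, ‖ζ‖ = 1 →
      IsGreatest (resolventNorms n r ζ) ‖(1 - extremalToeplitz n r)⁻¹‖ ∧
      resolventSup n r ζ = ‖(1 - extremalToeplitz n r)⁻¹‖) ∧
    -- and so is the supremum over all `ζ` outside the open unit disc
    IsGreatest {x : ℝ | ∃ ζ : ℂ, 1 ≤ ‖ζ‖ ∧ x ∈ resolventNorms n r ζ}
      ‖(1 - extremalToeplitz n r)⁻¹‖ := by

  obtain ⟨hr0, hr1⟩ := hr
  have hmem : extremalToeplitz n r ∈ contractionsWithRadius n r :=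
    ⟨Matrix.norm_extremalToeplitz_le_one hr0.le hr1, (Matrix.spectralRadius_le_ofReal_iff hr0.le).2
      (Matrix.norm_le_of_mem_spectrum_extremalToeplitz hr0.le)⟩
  have hone : ‖resolvent (extremalToeplitz n r) (1 : ℂ)‖ = ‖(1 - extremalToeplitz n r)⁻¹‖ := by
    rw [Matrix.resolvent_one]
  have hbound : ∀ T ∈ contractionsWithRadius n r, ∀ ζ : ℂ, 1 ≤ ‖ζ‖ →
      ‖resolvent T ζ‖ ≤ ‖(1 - extremalToeplitz n r)⁻¹‖ := fun T hT ζ hζ =>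
    Matrix.norm_resolvent_le_of_contraction hT.1 hr1
      ((Matrix.spectralRadius_le_ofReal_iff hr0.le).1 hT.2) hζ
  have hgreatest : ∀ ζ : ℂ, ‖ζ‖ = 1 →
      IsGreatest (resolventNorms n r ζ) ‖(1 - extremalToeplitz n r)⁻¹‖ := fun ζ hζ =>
    -- The maximiser at `ζ` is the rotated `ζ T*`, as `ζ - ζ T* = ζ (1 - T*)`.
    ⟨⟨ζ • extremalToeplitz n r, Matrix.smul_mem_contractionsWithRadius hr0.le hmem hζ,
      (Matrix.norm_resolvent_smul_self _ hζ).symm⟩, by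
      rintro _ ⟨T, hT, rfl⟩
      exact hbound T hT ζ hζ.ge⟩
  refine ⟨IsUnit.of_mul_eq_one_right _
      (Matrix.smul_lowerToeplitzX_mul_one_sub_extremalToeplitz hr1),
    fun T hT hs ζ hζ => ⟨fun hmem => ?_, hbound T ⟨hT, hs⟩ ζ hζ⟩, ?_, hmem, hone,
    fun ζ hζ => ⟨hgreatest ζ hζ, (hgreatest ζ hζ).csSup_eq⟩,
    ⟨1, norm_one.ge, extremalToeplitz n r, hmem, hone.symm⟩, ?_⟩
  · linarith [(Matrix.spectralRadius_le_ofReal_iff hr0.le).1 hs ζ hmem]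
  · rw [Matrix.inv_one_sub_extremalToeplitz hr1, Matrix.norm_one_div_smul_lowerToeplitzX hr1]
  · rintro _ ⟨ζ, hζ, T, hT, rfl⟩
    exact hbound T hT ζ hζ
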